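/- Let $A$ be a (unital, associative, not necessarily commutative) ring. Let $\mathfrak{C}$ be an $A$-coring with comultiplication $\Delta$ and counit $\varepsilon$, let $A\to B$ be a ring homomorphism, and let $\mathcal{T}=(\mathfrak{C},B,\langle -,-\rangle)$ be a right rational pairing over $A$. This means that $\langle-,-\rangle:\mathfrak{C}\times B\to A$ is a balanced $A$-bilinear form, that for every right $A$-module $M$ the map $\alpha_M: M\otimes_A\mathfrak{C}\to \mathrm{Hom}_A(B,M)$, $m\otimes c\mapsto[b\mapsto m\langle c,b\rangle]$, is injective, and that $\beta: B\to {}^*\mathfrak{C}=\mathrm{Hom}_A({}_A\mathfrak{C},{}_AA)$, $b\mapsto\langle-,b\rangle$, is a unital ring anti-morphism, where ${}^*\mathfrak{C}$ has the product $(f*g)(c)=\sum f(c_{(1)}g(c_{(2)}))$ and unit $\varepsilon$. Every right $\mathfrak{C}$-comodule $X$ is then a right $B$-module by $xb=\sum x_{(0)}\langle x_{(1)},b\rangle$. For a right $B$-module $M$ let $\mathrm{Rat}^{\mathcal T}(M)$ be the set of those $m\in M$ for which there is $\sum_i m_i\otimes c_i\in M\otimes_A\mathfrak{C}$ with $mb=\sum_i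 m_i\langle c_i,b\rangle$ for all $b\in B$. It is a right $\mathfrak{C}$-comodule with coaction $m\mapsto\sum_i m_i\otimes c_i$ (where the $m_i$ can be taken in $\mathrm{Rat}^{\mathcal T}(M)$), and this gives a functor $\mathrm{Rat}^{\mathcal T}:\mathrm{Mod}\text{-}B\to\mathrm{Comod}\text{-}\mathfrak{C}$. Assume that $\mathrm{Rat}^{\mathcal T}$ is exact. Let $\Sigma$ be a finitely generated and projective object of the abelian category $\mathrm{Comod}\text{-}\mathfrak{C}$ of right $\mathfrak{C}$-comodules. Put $T_\Sigma=\mathrm{End}_{\mathfrak{C}}(\Sigma)$ and $\Sigma^\star=\mathrm{Hom}_B(\Sigma,B)$, which is a $(B,T_\Sigma)$-bimodule, and put $$\mathrm{Coind}_\Sigma=\mathrm{Rat}^{\mathcal T}\circ\mathrm{Hom}_{T_\Sigma}(\Sigma^\star,-):\ \mathrm{Mod}\text{-}T_\Sigma\to\mathrm{Comod}\text{-}\mathfrak{C},\qquad \mathcal{C}_\Sigma=\{L\in\mathrm{Comod}\text{-}\mathfrak{C}\mid \mathrm{Hom}_{\mathfrak{C}}(\Sigma,L)=0\}.$$ Let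 $\mathbf{T}_\Sigma:\mathrm{Comod}\text{-}\mathfrak{C}\to\mathrm{Comod}\text{-}\mathfrak{C}/\mathcal{C}_\Sigma$ be the canonical functor to the quotient category (the localization at the colinear maps whose kernel and cokernel lie in $\mathcal{C}_\Sigma$). Then: 1. $\mathcal{C}_\Sigma$ is a TTF-class, i.e. it is the torsion-free class of some torsion theory and the torsion class of some torsion theory in $\mathrm{Comod}\text{-}\mathfrak{C}$. 2. $\mathbf{T}_\Sigma$ is a localizing functor, i.e. it has a right adjoint. 3. There is a functor $\mathbf{R}_\Sigma:\mathrm{Comod}\text{-}\mathfrak{C}/\mathcal{C}_\Sigma\to\mathrm{Mod}\text{-}T_\Sigma$ with $\mathbf{R}_\Sigma\circ\mathbf{T}_\Sigma=\mathrm{Hom}_{\mathfrak{C}}(\Sigma,-)$, and $\mathbf{R}_\Sigma$ is an equivalence of categories with inverse $\mathbf{L}_\Sigma=\mathbf{T}_\Sigma\circ\mathrm{Coind}_\Sigma$. -/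

import Mathlib

open CategoryTheory Limits MulOpposite
open scoped TensorProduct

universe u

noncomputable section

namespace CoringCoind

/-! ### Tensor product over a noncommutative ring

A right `A`-module is an additive group with a `Module Aᵐᵒᵖ` structure, `m · a = op a • m`. -/

section Tensor

variable (A : Type*) [Ring A]
variable (M : Type*) [AddCommGroup M] [Module Aᵐᵒᵖ M]
variable (N : Type*) [AddCommGroup N] [Module A N]

/-- The relations `(m · a) ⊗ n = m ⊗ (a · n)`. -/
def balancedRel : AddSubgroup (M ⊗[ℤ] N) :=
  AddSubgroup.closure
    {t | ∃ (m : M) (a : A) (n : N), t = (op a • m) ⊗ₜ[ℤ] n - m ⊗ₜ[ℤ] (a • n)}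

/-- The tensor product `M ⊗_A N` of a right and a left module over a (noncommutative) ring. -/
def Tens : Type _ := (M ⊗[ℤ] N) ⧸ balancedRel A M N

instance : AddCommGroup (Tens A M N) :=
  inferInstanceAs (AddCommGroup ((M ⊗[ℤ] N) ⧸ balancedRel A M N))

/-- The projection `M ⊗_ℤ N → M ⊗_A N`. -/
def tensMk : M ⊗[ℤ] N →+ Tens A M N := QuotientAddGroup.mk' (balancedRel A M N)

variable {M N}

/-- The pure tensor `m ⊗ n`. -/
def tmul (m : M) (n : N) : Tens A M N := tensMk A M N (m ⊗ₜ[ℤ] n)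

variable {A}

theorem tmul_add (m : M) (n n' : N) : tmul A m (n + n') = tmul A m n + tmul A m n' := by
  simp only [tmul, TensorProduct.tmul_add, map_add]

theorem add_tmul (m m' : M) (n : N) : tmul A (m + m') n = tmul A m n + tmul A m' n := by
  simp only [tmul, TensorProduct.add_tmul, map_add]

theorem op_smul_tmul (a : A) (m : M) (n : N) : tmul A (op a • m) n = tmul A m (a • n) := by
  unfold tmul
  refine sub_eq_zero.1 ?_
  rw [← map_sub]
  exact (QuotientAddGroup.eq_zero_iff _).2 (AddSubgroup.subset_closure ⟨m, a, n, rfl⟩)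

@[elab_as_elim]
theorem tens_induction {p : Tens A M N → Prop} (z : Tens A M N) (h0 : p 0)
    (ht : ∀ m n, p (tmul A m n)) (ha : ∀ x y, p x → p y → p (x + y)) : p z := by
  obtain ⟨t, rfl⟩ : ∃ t, tensMk A M N t = z := QuotientAddGroup.mk'_surjective _ z
  induction t with
  | zero => rw [map_zero]; exact h0
  | tmul m n => exact ht m n
  | add x y hx hy => rw [map_add]; exact ha _ _ hx hy

variable {P : Type*} [AddCommGroup P]

/-- The universal property of `M ⊗_A N`: a balanced biadditive map induces an additive map. -/
def lift (f : M →+ N →+ P) (hf : ∀ (a : A) m n, f (op a • m) n = f m (a • n)) :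
    Tens A M N →+ P :=
  QuotientAddGroup.lift (balancedRel A M N)
    (TensorProduct.liftAddHom f (fun r m n => by simp)) (by
      rw [balancedRel, AddSubgroup.closure_le]
      rintro _ ⟨m, a, n, rfl⟩
      simp [AddMonoidHom.mem_ker, hf])

@[simp]
theorem lift_tmul (f : M →+ N →+ P) (hf : ∀ (a : A) m n, f (op a • m) n = f m (a • n))
    (m : M) (n : N) : lift f hf (tmul A m n) = f m n :=
  rfl

theorem hom_ext {f g : Tens A M N →+ P} (h : ∀ m n, f (tmul A m n) = g (tmul A m n)) :
    f = g := by
  ext z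
  induction z using tens_induction with
  | h0 => simp
  | ht m n => exact h m n
  | ha x y hx hy => simp [hx, hy]

variable (A) in
/-- `tmul` as a biadditive map. -/
def tmulHom : M →+ N →+ Tens A M N :=
  AddMonoidHom.mk' (fun m => AddMonoidHom.mk' (tmul A m) (tmul_add m))
    (fun m m' => by ext n; exact add_tmul m m' n)

@[simp] theorem tmulHom_apply (m : M) (n : N) : tmulHom A m n = tmul A m n := rfl

variable {M' : Type*} [AddCommGroup M'] [Module Aᵐᵒᵖ M']
variable {N' : Type*} [AddCommGroup N'] [Module A N']

/-- `f ⊗_A N`. -/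
def rT (N : Type*) [AddCommGroup N] [Module A N] (f : M →ₗ[Aᵐᵒᵖ] M') :
    Tens A M N →+ Tens A M' N :=
  lift ((tmulHom A).comp f.toAddMonoidHom) (fun a m n => by simp [op_smul_tmul])

/-- `M ⊗_A g`. -/
def lT (M : Type*) [AddCommGroup M] [Module Aᵐᵒᵖ M] (g : N →ₗ[A] N') :
    Tens A M N →+ Tens A M N' :=
  lift ((AddMonoidHom.compHom' g.toAddMonoidHom).comp (tmulHom A))
    (fun a m n => by simp [op_smul_tmul])

@[simp] theorem rT_tmul (f : M →ₗ[Aᵐᵒᵖ] M') (m : M) (n : N) :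
    rT N f (tmul A m n) = tmul A (f m) n := lift_tmul _ _ _ _

@[simp] theorem lT_tmul (g : N →ₗ[A] N') (m : M) (n : N) :
    lT M g (tmul A m n) = tmul A m (g n) := lift_tmul _ _ _ _

/-- The right action of `A` on a bimodule, as left linear maps. -/
def actR [Module Aᵐᵒᵖ N] [SMulCommClass A Aᵐᵒᵖ N] (a : Aᵐᵒᵖ) : N →ₗ[A] N where
  toFun n := a • n
  map_add' := smul_add a
  map_smul' r n := (smul_comm r a n).symm

/-- The left action of `A` on a bimodule, as right linear maps. -/
def actL [Module A M] [SMulCommClass A Aᵐᵒᵖ M] (a : A) : M →ₗ[Aᵐᵒᵖ] M where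
  toFun m := a • m
  map_add' := smul_add a
  map_smul' r m := smul_comm a r m

/-- If `N` is an `A`-bimodule, `M ⊗_A N` is a right `A`-module, `(m ⊗ n) · a = m ⊗ (n · a)`. -/
instance [Module Aᵐᵒᵖ N] [SMulCommClass A Aᵐᵒᵖ N] : Module Aᵐᵒᵖ (Tens A M N) where
  smul a := lT M (actR (A := A) (N := N) a)
  one_smul z := by
    change lT M (actR (A := A) (N := N) 1) z = z
    induction z using tens_induction with
    | h0 => exact map_zero _
    | ht m n => simp [actR]
    | ha x y hx hy => rw [map_add, hx, hy]
  mul_smul a b z := by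
    change lT M (actR (A := A) (N := N) (a * b)) z = lT M (actR (A := A) (N := N) a) (lT M (actR (A := A) (N := N) b) z)
    induction z using tens_induction with
    | h0 => simp only [map_zero]
    | ht m n => simp [actR, mul_smul]
    | ha x y hx hy => simp only [map_add, hx, hy]
  smul_zero a := map_zero (lT M (actR (A := A) (N := N) a))
  smul_add a := map_add (lT M (actR (A := A) (N := N) a))
  add_smul a b z := by
    change lT M (actR (A := A) (N := N) (a + b)) z = lT M (actR (A := A) (N := N) a) z + lT M (actR (A := A) (N := N) b) z
    induction z using tens_induction with
    | h0 => simp only [map_zero, add_zero]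
    | ht m n => simp [actR, add_smul, tmul_add]
    | ha x y hx hy => simp only [map_add, hx, hy]; abel
  zero_smul z := by
    change lT M (actR (A := A) (N := N) 0) z = 0
    induction z using tens_induction with
    | h0 => exact map_zero _
    | ht m n => simpa [actR] using (tmulHom A m : N →+ _).map_zero
    | ha x y hx hy => rw [map_add, hx, hy, add_zero]

@[simp] theorem op_smul_tmul' [Module Aᵐᵒᵖ N] [SMulCommClass A Aᵐᵒᵖ N] (a : Aᵐᵒᵖ) (m : M) (n : N) :
    a • tmul A m n = tmul A m (a • n) :=
  lT_tmul (actR a) m n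

/-- If `M` is an `A`-bimodule, `M ⊗_A N` is a left `A`-module, `a · (m ⊗ n) = (a · m) ⊗ n`. -/
instance [Module A M] [SMulCommClass A Aᵐᵒᵖ M] : Module A (Tens A M N) where
  smul a := rT N (actL (A := A) (M := M) a)
  one_smul z := by
    change rT N (actL (A := A) (M := M) 1) z = z
    induction z using tens_induction with
    | h0 => exact map_zero _
    | ht m n => simp [actL]
    | ha x y hx hy => rw [map_add, hx, hy]
  mul_smul a b z := by
    change rT N (actL (A := A) (M := M) (a * b)) z = rT N (actL (A := A) (M := M) a) (rT N (actL (A := A) (M := M) b) z)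
    induction z using tens_induction with
    | h0 => simp only [map_zero]
    | ht m n => simp [actL, mul_smul]
    | ha x y hx hy => simp only [map_add, hx, hy]
  smul_zero a := map_zero (rT N (actL (A := A) (M := M) a))
  smul_add a := map_add (rT N (actL (A := A) (M := M) a))
  add_smul a b z := by
    change rT N (actL (A := A) (M := M) (a + b)) z = rT N (actL (A := A) (M := M) a) z + rT N (actL (A := A) (M := M) b) z
    induction z using tens_induction with
    | h0 => simp only [map_zero, add_zero]
    | ht m n => simp [actL, add_smul, add_tmul]
    | ha x y hx hy => simp only [map_add, hx, hy]; abel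
  zero_smul z := by
    change rT N (actL (A := A) (M := M) 0) z = 0
    induction z using tens_induction with
    | h0 => exact map_zero _
    | ht m n =>
      have h : tmul A (0 : M) n = 0 :=
        DFunLike.congr_fun (tmulHom A : M →+ N →+ Tens A M N).map_zero n
      simpa [actL] using h
    | ha x y hx hy => rw [map_add, hx, hy, add_zero]

@[simp] theorem smul_tmul' [Module A M] [SMulCommClass A Aᵐᵒᵖ M] (a : A) (m : M) (n : N) :
    a • tmul A m n = tmul A (a • m) n :=
  rT_tmul (actL a) m n

variable (A) in
/-- The right linear map `n ↦ m ⊗ n` for a bimodule `N`. -/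
def tmulRight [Module Aᵐᵒᵖ N] [SMulCommClass A Aᵐᵒᵖ N] (m : M) : N →ₗ[Aᵐᵒᵖ] Tens A M N where
  toFun := tmul A m
  map_add' := tmul_add m
  map_smul' a n := (op_smul_tmul' a m n).symm

/-- The associativity isomorphism `M ⊗ (N ⊗ P) → (M ⊗ N) ⊗ P`, `m ⊗ (n ⊗ p) ↦ (m ⊗ n) ⊗ p`. -/
def assocInv (M N P : Type*) [AddCommGroup M] [Module Aᵐᵒᵖ M] [AddCommGroup N] [Module A N]
    [Module Aᵐᵒᵖ N] [SMulCommClass A Aᵐᵒᵖ N] [AddCommGroup P] [Module A P] :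
    Tens A M (Tens A N P) →+ Tens A (Tens A M N) P :=
  lift (AddMonoidHom.mk' (fun m => rT P (tmulRight A m)) (fun m m' => hom_ext fun n p => by
      simp [tmulRight, add_tmul]))
    (fun a m t => by
      induction t using tens_induction with
      | h0 => simp
      | ht n p => simp [tmulRight, op_smul_tmul]
      | ha x y hx hy => simp_all)

@[simp] theorem assocInv_tmul [Module Aᵐᵒᵖ N] [SMulCommClass A Aᵐᵒᵖ N] [Module A P] (m : M)
    (t : Tens A N P) : assocInv M N P (tmul A m t) = rT P (tmulRight A m) t := by
  simp [assocInv]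

/-- Contraction of `M ⊗_A N` along a left linear form: `m ⊗ n ↦ m · g(n)`. -/
def ctr (M : Type*) [AddCommGroup M] [Module Aᵐᵒᵖ M] (g : N →ₗ[A] A) : Tens A M N →+ M :=
  lift (AddMonoidHom.mk' (fun m => AddMonoidHom.mk' (fun n => op (g n) • m)
      (fun n n' => by simp [add_smul])) (fun m m' => by ext n; simp))
    (fun a m n => by simp [mul_smul])

@[simp] theorem ctr_tmul (g : N →ₗ[A] A) (m : M) (n : N) :
    ctr M g (tmul A m n) = op (g n) • m := by simp [ctr]

end Tensor

/-! ### More on contractions -/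

section Contraction

variable {A : Type*} [Ring A]
variable {M : Type*} [AddCommGroup M] [Module Aᵐᵒᵖ M]
variable {M' : Type*} [AddCommGroup M'] [Module Aᵐᵒᵖ M']
variable {N : Type*} [AddCommGroup N] [Module A N]

theorem ctr_add (g g' : N →ₗ[A] A) (z : Tens A M N) :
    ctr M (g + g') z = ctr M g z + ctr M g' z := by
  induction z using tens_induction with
  | h0 => simp only [map_zero, add_zero]
  | ht m n => simp [add_smul]
  | ha x y hx hy => simp only [map_add, hx, hy]; abel

theorem ctr_zero (z : Tens A M N) : ctr M (0 : N →ₗ[A] A) z = 0 := by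
  induction z using tens_induction with
  | h0 => exact map_zero _
  | ht m n => simp
  | ha x y hx hy => rw [map_add, hx, hy, add_zero]

theorem ctr_rT (g : N →ₗ[A] A) (f : M →ₗ[Aᵐᵒᵖ] M') (z : Tens A M N) :
    ctr M' g (rT N f z) = f (ctr M g z) := by
  induction z using tens_induction with
  | h0 => simp only [map_zero]
  | ht m n => simp
  | ha x y hx hy => simp only [map_add, hx, hy]

theorem ctr_lT (g : N →ₗ[A] A) (h : N →ₗ[A] N) (z : Tens A M N) :
    ctr M g (lT M h z) = ctr M (g ∘ₗ h) z := by
  induction z using tens_induction with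
  | h0 => simp only [map_zero]
  | ht m n => simp
  | ha x y hx hy => simp only [map_add, hx, hy]

theorem ctr_smul [Module A M] [SMulCommClass A Aᵐᵒᵖ M] (g : N →ₗ[A] A) (a : A)
    (z : Tens A M N) : ctr M g (a • z) = a • ctr M g z := by
  induction z using tens_induction with
  | h0 => simp only [map_zero, smul_zero]
  | ht m n => simp [smul_comm]
  | ha x y hx hy => simp only [map_add, smul_add, hx, hy]

theorem rT_id (z : Tens A M N) :
    rT N (LinearMap.id : M →ₗ[Aᵐᵒᵖ] M) z = z := by
  induction z using tens_induction with
  | h0 => exact map_zero _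
  | ht m n => simp
  | ha x y hx hy => rw [map_add, hx, hy]

theorem rT_comp {M'' : Type*} [AddCommGroup M''] [Module Aᵐᵒᵖ M''] (g : M' →ₗ[Aᵐᵒᵖ] M'')
    (f : M →ₗ[Aᵐᵒᵖ] M') (z : Tens A M N) : rT N (g ∘ₗ f) z = rT N g (rT N f z) := by
  induction z using tens_induction with
  | h0 => simp only [map_zero]
  | ht m n => simp
  | ha x y hx hy => simp only [map_add, hx, hy]

theorem rT_add (f g : M →ₗ[Aᵐᵒᵖ] M') (z : Tens A M N) :
    rT N (f + g) z = rT N f z + rT N g z := by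
  induction z using tens_induction with
  | h0 => simp only [map_zero, add_zero]
  | ht m n => simp [add_tmul]
  | ha x y hx hy => simp only [map_add, hx, hy]; abel

/-- `rT` is additive in the map. -/
def rTHom (z : Tens A M N) : (M →ₗ[Aᵐᵒᵖ] M') →+ Tens A M' N :=
  AddMonoidHom.mk' (fun f => rT N f z) (fun f g => rT_add f g z)

/-- If `z` goes to zero in `(M / K) ⊗_A N`, it comes from `K ⊗_A N`. -/
theorem exists_of_rT_mkQ (K : Submodule Aᵐᵒᵖ M) (z : Tens A M N) (hz : rT N K.mkQ z = 0) :
    ∃ w : Tens A K N, rT N K.subtype w = z := by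
  let R : AddSubgroup (Tens A M N) := (rT N K.subtype).range
  let q : Tens A M N →+ Tens A M N ⧸ R := QuotientAddGroup.mk' R
  let f : M ⧸ K →+ N →+ Tens A M N ⧸ R :=
    QuotientAddGroup.lift K.toAddSubgroup ((AddMonoidHom.compHom q).comp (tmulHom A)) (by
      intro m hm
      ext n
      exact (QuotientAddGroup.eq_zero_iff _).2 ⟨tmul A (⟨m, hm⟩ : K) n, by simp⟩)
  have hf : ∀ m n, f (K.mkQ m) n = q (tmul A m n) := fun _ _ => rfl
  let F : Tens A (M ⧸ K) N →+ Tens A M N ⧸ R := lift f (by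
    intro a m n
    obtain ⟨m, rfl⟩ := K.mkQ_surjective m
    rw [← map_smul, hf, hf, op_smul_tmul])
  have hF : ∀ t, F (rT N K.mkQ t) = q t := by
    intro t
    induction t using tens_induction with
    | h0 => simp only [map_zero]
    | ht m n => rw [rT_tmul, lift_tmul, hf]
    | ha x y hx hy => simp only [map_add, hx, hy]
  have h0 : q z = 0 := by rw [← hF, hz, map_zero]
  exact (QuotientAddGroup.eq_zero_iff _).1 h0

end Contraction

/-! ### Corings -/

/-- An `A`-coring: a coassociative counital comonoid in `A`-bimodules. -/
class Coring (A : Type u) [Ring A] (C : Type u) [AddCommGroup C] [Module A C] [Module Aᵐᵒᵖ C]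
    [SMulCommClass A Aᵐᵒᵖ C] where
  /-- the comultiplication, as a left linear map -/
  comul : C →ₗ[A] Tens A C C
  comul_op_smul : ∀ (a : A) (c : C), comul (op a • c) = op a • comul c
  /-- the counit, as a left linear map -/
  counit : C →ₗ[A] A
  counit_op_smul : ∀ (a : A) (c : C), counit (op a • c) = counit c * a
  /-- `(Δ ⊗ C) ∘ Δ = (C ⊗ Δ) ∘ Δ` -/
  coassoc : ∀ c : C,
    rT C { toFun := comul, map_add' := map_add comul, map_smul' := fun a => comul_op_smul a.unop }
      (comul c) = assocInv C C C (lT C comul (comul c))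
  /-- `∑ c₁ · ε(c₂) = c` -/
  comul_counit : ∀ c : C, ctr C counit (comul c) = c
  /-- `∑ ε(c₁) · c₂ = c` -/
  counit_comul : ∀ c : C,
    lift (AddMonoidHom.mk' (fun x => AddMonoidHom.mk' (fun y : C => counit x • y) (smul_add _))
        (fun x x' => by ext y; simp [add_smul]))
      (fun a x y => by simp [counit_op_smul, mul_smul]) (comul c) = c

section CoringDefs

variable {A : Type u} [Ring A] {C : Type u} [AddCommGroup C] [Module A C] [Module Aᵐᵒᵖ C]
  [SMulCommClass A Aᵐᵒᵖ C] [Coring A C]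

/-- `c ↦ ∑ c₁ · g(c₂)`. -/
def hit (g : C →ₗ[A] A) : C →ₗ[A] C where
  toFun c := ctr C g (Coring.comul c)
  map_add' c c' := by rw [map_add, map_add]
  map_smul' a c := by rw [map_smul, ctr_smul]; rfl

/-- The product of the left dual convolution ring `*C = Hom_A(_A C, _A A)`:
`(f * g)(c) = ∑ f(c₁ · g(c₂))`. Its unit is the counit. -/
def conv (f g : C →ₗ[A] A) : C →ₗ[A] A := f ∘ₗ hit g

theorem ctr_assocInv {M : Type*} [AddCommGroup M] [Module Aᵐᵒᵖ M] (g : C →ₗ[A] A)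
    (z : Tens A M C) :
    ctr (Tens A M C) g (assocInv M C C (lT M Coring.comul z)) = lT M (hit g) z := by
  induction z using tens_induction with
  | h0 => simp only [map_zero]
  | ht m c => rw [lT_tmul, assocInv_tmul, ctr_rT, lT_tmul]; rfl
  | ha x y hx hy => simp only [map_add, hx, hy]

end CoringDefs

/-! ### The category of right comodules -/

section Comodules

variable (A : Type u) [Ring A] (C : Type u) [AddCommGroup C] [Module A C] [Module Aᵐᵒᵖ C]
  [SMulCommClass A Aᵐᵒᵖ C] [Coring A C]

/-- Right comodules over an `A`-coring `C`. -/
structure RComod : Type (u + 1) where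
  carrier : Type u
  [grp : AddCommGroup carrier]
  [mod : Module Aᵐᵒᵖ carrier]
  /-- the coaction `ρ` -/
  coact : carrier →ₗ[Aᵐᵒᵖ] Tens A carrier C
  /-- `(ρ ⊗ C) ∘ ρ = (M ⊗ Δ) ∘ ρ` -/
  coassoc : ∀ m, rT C coact (coact m) = assocInv carrier C C (lT carrier Coring.comul (coact m))
  /-- `∑ m₀ · ε(m₁) = m` -/
  counit : ∀ m, ctr carrier (Coring.counit : C →ₗ[A] A) (coact m) = m

attribute [instance] RComod.grp RComod.mod

variable {A C}

/-- Colinear maps: right `A`-linear maps with `ρ ∘ f = (f ⊗ C) ∘ ρ`. -/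
@[ext]
structure RComod.Hom (X Y : RComod A C) where
  lin : X.carrier →ₗ[Aᵐᵒᵖ] Y.carrier
  comm : ∀ x, Y.coact (lin x) = rT C lin (X.coact x)

instance : Category (RComod A C) where
  Hom := RComod.Hom
  id X := ⟨LinearMap.id, fun x => (rT_id _).symm⟩
  comp f g := ⟨g.lin ∘ₗ f.lin, fun x => by
    rw [LinearMap.comp_apply, g.comm, f.comm, rT_comp]⟩

namespace RComod

variable {X Y Z : RComod A C}

@[ext] theorem hom_ext' {f g : X ⟶ Y} (h : ∀ x, f.lin x = g.lin x) : f = g :=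
  RComod.Hom.ext (LinearMap.ext h)

@[simp] theorem id_lin : (𝟙 X : X ⟶ X).lin = LinearMap.id := rfl

@[simp] theorem comp_lin (f : X ⟶ Y) (g : Y ⟶ Z) : (f ≫ g).lin = g.lin ∘ₗ f.lin := rfl

variable (X Y) in
/-- The colinear maps as a subgroup of the linear maps. -/
def homSubgroup : AddSubgroup (X.carrier →ₗ[Aᵐᵒᵖ] Y.carrier) where
  carrier := {f | ∀ x, Y.coact (f x) = rT C f (X.coact x)}
  zero_mem' x := by
    rw [LinearMap.zero_apply, map_zero]; exact ((rTHom (X.coact x)).map_zero).symm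
  add_mem' {f g} hf hg x := by
    rw [LinearMap.add_apply, map_add, hf, hg]; exact ((rTHom (X.coact x)).map_add f g).symm
  neg_mem' {f} hf x := by
    rw [LinearMap.neg_apply, map_neg, hf]; exact ((rTHom (X.coact x)).map_neg f).symm

variable (X Y) in
/-- Colinear maps form the subgroup `homSubgroup`. -/
def homEquiv : (X ⟶ Y) ≃ homSubgroup X Y where
  toFun f := ⟨f.lin, f.comm⟩
  invFun f := ⟨f.1, f.2⟩

instance : AddCommGroup (X ⟶ Y) := (homEquiv X Y).addCommGroup

@[simp] theorem add_lin (f g : X ⟶ Y) : (f + g).lin = f.lin + g.lin := rfl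

instance : Preadditive (RComod A C) where
  add_comp _ _ _ f g h := by ext x; simp
  comp_add _ _ _ f g h := by ext x; simp

end RComod

end Comodules

/-! ### Rational pairings and rational functors -/

section Pairing

variable (A : Type u) [Ring A] (C : Type u) [AddCommGroup C] [Module A C] [Module Aᵐᵒᵖ C]
  [SMulCommClass A Aᵐᵒᵖ C] (B : Type u) [Ring B] (φ : A →+* B)

/-- Balanced `A`-bilinear forms `C × B → A` for an `A`-bimodule `C` and an `A`-ring `φ : A → B`. -/
structure BalancedForm where
  form : C →+ B →+ A
  smul_left : ∀ (a : A) (c : C) (b : B), form (a • c) b = a * form c b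
  balanced : ∀ (a : A) (c : C) (b : B), form (op a • c) b = form c (φ a * b)
  smul_right : ∀ (a : A) (c : C) (b : B), form c (b * φ a) = form c b * a

variable {A C B φ}

/-- `β_A : B → *C`, `β_A(b)(c) = ⟨c, b⟩`. -/
def BalancedForm.beta (T : BalancedForm A C B φ) (b : B) : C →ₗ[A] A where
  toFun c := T.form c b
  map_add' c c' := by simp
  map_smul' a c := T.smul_left a c b

/-- `α_M : M ⊗_A C → Hom_A(B, M)`, `m ⊗ c ↦ [b ↦ m · ⟨c, b⟩]`. -/
def BalancedForm.alpha (T : BalancedForm A C B φ) (M : Type u) [AddCommGroup M] [Module Aᵐᵒᵖ M]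
    (z : Tens A M C) (b : B) : M := ctr M (T.beta b) z

variable (A C B φ) in
/-- A right rational pairing `(C, B, ⟨-,-⟩)` over `A`: all the maps `α_M` are injective and
`β_A : B → *C` is an anti-morphism of rings. -/
structure RationalPairing [Coring A C] extends BalancedForm A C B φ where
  alpha_injective : ∀ (M : Type u) [AddCommGroup M] [Module Aᵐᵒᵖ M],
    Function.Injective (toBalancedForm.alpha M)
  beta_one : toBalancedForm.beta 1 = Coring.counit
  beta_mul : ∀ b b' : B,
    toBalancedForm.beta (b * b') = conv (toBalancedForm.beta b') (toBalancedForm.beta b)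

variable [Coring A C]

/-- The right `A`-module structure of `M` is the restriction of its `B`-module structure. -/
class IsRestr (φ : A →+* B) (M : Type u) [AddCommGroup M] [Module Aᵐᵒᵖ M] [Module Bᵐᵒᵖ M] :
    Prop where
  smul_eq : ∀ (a : A) (m : M), op (φ a) • m = op a • m

/-- A right `B`-module with its restricted right `A`-module structure. -/
def Restr (_φ : A →+* B) (M : Type u) : Type u := M

section

variable (φ) (M : Type u) [AddCommGroup M] [Module Bᵐᵒᵖ M]

instance : AddCommGroup (Restr φ M) := inferInstanceAs (AddCommGroup M)
instance : Module Bᵐᵒᵖ (Restr φ M) := inferInstanceAs (Module Bᵐᵒᵖ M)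
instance : Module Aᵐᵒᵖ (Restr φ M) := Module.compHom M φ.op
instance : IsRestr φ (Restr φ M) where
  smul_eq _ _ := rfl

end

namespace RationalPairing

variable (T : RationalPairing A C B φ)

theorem ctr_op_smul {M : Type u} [AddCommGroup M] [Module Aᵐᵒᵖ M] (a : A) (b : B)
    (z : Tens A M C) : ctr M (T.beta b) (op a • z) = ctr M (T.beta (φ a * b)) z := by
  induction z using tens_induction with
  | h0 => simp only [smul_zero, map_zero]
  | ht m c => rw [op_smul_tmul', ctr_tmul, ctr_tmul]; congr 2; exact T.balanced a c b
  | ha x y hx hy => simp only [smul_add, map_add, hx, hy]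

section Rat

variable (M : Type u) [AddCommGroup M] [Module Aᵐᵒᵖ M] [Module Bᵐᵒᵖ M]

variable {M} in
/-- `m` is rational: there is `∑ mᵢ ⊗ cᵢ ∈ M ⊗_A C` with `m · b = ∑ mᵢ ⟨cᵢ, b⟩` for all `b`. -/
def IsRational (m : M) : Prop := ∃ z : Tens A M C, ∀ b : B, op b • m = T.alpha M z b

variable [IsRestr φ M]

/-- `Rat(M)`, the set of rational elements, as a right `A`-submodule. -/
def rat : Submodule Aᵐᵒᵖ M where
  carrier := {m | T.IsRational m}
  zero_mem' := ⟨0, fun b => by rw [smul_zero]; exact (map_zero _).symm⟩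
  add_mem' := by
    rintro m m' ⟨z, hz⟩ ⟨z', hz'⟩
    exact ⟨z + z', fun b => by rw [smul_add, hz, hz']; exact (map_add _ _ _).symm⟩
  smul_mem' := by
    rintro a m ⟨z, hz⟩
    refine ⟨a • z, fun b => ?_⟩
    obtain ⟨a, rfl⟩ := op_surjective a
    rw [← IsRestr.smul_eq (φ := φ), smul_smul, ← op_mul, hz]
    exact (T.ctr_op_smul a b z).symm

variable {M}

/-- `Rat(M)` is closed under the action of `B`. -/
theorem op_smul_mem_rat (b : B) {m : M} (hm : m ∈ T.rat M) : op b • m ∈ T.rat M := by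
  obtain ⟨z, hz⟩ := hm
  refine ⟨lT M (hit (T.beta b)) z, fun b' => ?_⟩
  rw [smul_smul, ← op_mul, hz]
  unfold BalancedForm.alpha
  rw [ctr_lT, T.beta_mul]; rfl

theorem exists_coact (m : T.rat M) :
    ∃ w : Tens A (T.rat M) C, ∀ b, ((T.alpha (T.rat M) w b : T.rat M) : M) = op b • (m : M) := by
  obtain ⟨z, hz⟩ := m.2
  obtain ⟨w, rfl⟩ := exists_of_rT_mkQ (T.rat M) z (T.alpha_injective _ (by
    funext b
    unfold BalancedForm.alpha
    rw [ctr_rT, map_zero]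
    rw [Submodule.mkQ_apply, Submodule.Quotient.mk_eq_zero]
    have := T.op_smul_mem_rat b m.2
    rwa [hz] at this))
  refine ⟨w, fun b => ?_⟩
  rw [hz]
  exact (ctr_rT _ (T.rat M).subtype _).symm

/-- The coaction of `Rat(M)`: `ρ(m) = ∑ mᵢ ⊗ cᵢ` where `m · b = ∑ mᵢ ⟨cᵢ, b⟩` for all `b`. -/
def ratCoactFun (m : T.rat M) : Tens A (T.rat M) C := (T.exists_coact m).choose

theorem ratCoactFun_spec (m : T.rat M) (b : B) :
    ((ctr (T.rat M) (T.beta b) (T.ratCoactFun m) : T.rat M) : M) = op b • (m : M) :=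
  (T.exists_coact m).choose_spec b

theorem tens_ext {N : Type u} [AddCommGroup N] [Module Aᵐᵒᵖ N] {w w' : Tens A N C}
    (h : ∀ b, ctr N (T.beta b) w = ctr N (T.beta b) w') : w = w' :=
  T.alpha_injective N (funext h)

variable (M) in
/-- The coaction of `Rat(M)` as a linear map. -/
def ratCoact : T.rat M →ₗ[Aᵐᵒᵖ] Tens A (T.rat M) C where
  toFun := T.ratCoactFun
  map_add' m m' := T.tens_ext fun b => Subtype.ext (by
    rw [map_add, Submodule.coe_add]
    simp only [ratCoactFun_spec, Submodule.coe_add, smul_add])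
  map_smul' a m := T.tens_ext fun b => Subtype.ext (by
    obtain ⟨a, rfl⟩ := op_surjective a
    rw [RingHom.id_apply, ctr_op_smul]
    simp only [ratCoactFun_spec, Submodule.coe_smul]
    rw [← IsRestr.smul_eq (φ := φ), smul_smul, ← op_mul])

theorem ratCoact_spec (m : T.rat M) (b : B) :
    ((ctr (T.rat M) (T.beta b) (T.ratCoact M m) : T.rat M) : M) = op b • (m : M) :=
  T.ratCoactFun_spec m b

variable (M) in
/-- `Rat(M)` as a right `C`-comodule. -/
def ratComod : RComod A C where
  carrier := T.rat M
  coact := T.ratCoact M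
  coassoc m := T.tens_ext fun b => T.tens_ext fun b' => Subtype.ext (by
    rw [ctr_rT, ctr_assocInv, ctr_lT, ratCoact_spec, ratCoact_spec]
    change _ = ((ctr _ (conv (T.beta b') (T.beta b)) (T.ratCoact M m) : T.rat M) : M)
    rw [← T.beta_mul, ratCoact_spec, smul_smul, ← op_mul])
  counit m := Subtype.ext (by rw [← T.beta_one, ratCoact_spec, op_one, one_smul])

variable {M' : Type u} [AddCommGroup M'] [Module Aᵐᵒᵖ M'] [Module Bᵐᵒᵖ M'] [IsRestr φ M']

theorem map_mem_rat (g : M →ₗ[Aᵐᵒᵖ] M') (hg : ∀ (b : B) (m : M), g (op b • m) = op b • g m) :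
    ∀ m ∈ T.rat M, g m ∈ T.rat M' := by
  rintro m ⟨z, hz⟩
  refine ⟨rT C g z, fun b => ?_⟩
  rw [← hg, hz]
  exact (ctr_rT _ _ _).symm

theorem ratCoact_restrict (g : M →ₗ[Aᵐᵒᵖ] M')
    (hg : ∀ (b : B) (m : M), g (op b • m) = op b • g m) (m : T.rat M) :
    T.ratCoact M' (g.restrict (T.map_mem_rat g hg) m) =
      rT C (g.restrict (T.map_mem_rat g hg)) (T.ratCoact M m) :=
  T.tens_ext fun b => Subtype.ext (by
    rw [ctr_rT, ratCoact_spec, LinearMap.coe_restrict_apply, LinearMap.coe_restrict_apply,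
      ratCoact_spec, hg])

/-- A `B`-linear map restricts to a colinear map between the rational parts. -/
def ratMap (g : M →ₗ[Aᵐᵒᵖ] M') (hg : ∀ (b : B) (m : M), g (op b • m) = op b • g m) :
    T.ratComod M ⟶ T.ratComod M' :=
  RComod.Hom.mk (X := T.ratComod M) (Y := T.ratComod M')
    (g.restrict (T.map_mem_rat g hg)) (T.ratCoact_restrict g hg)

end Rat

/-- The functor `Rat : Mod-B ⥤ Comod-C`. -/
def ratFunctor : ModuleCat.{u} Bᵐᵒᵖ ⥤ RComod A C where
  obj M := T.ratComod (Restr φ M)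
  map f := T.ratMap
    { toFun := f.hom
      map_add' := map_add f.hom
      map_smul' := fun a m => f.hom.map_smul (φ.op a) m }
    (fun b m => f.hom.map_smul (op b) m)
  map_id _ := rfl
  map_comp _ _ := rfl

/-! ### Comodules as modules over `B` -/

/-- The underlying group of a comodule, to be regarded as a right `B`-module. -/
def Und (_T : RationalPairing A C B φ) (X : RComod A C) : Type u := X.carrier

instance (X : RComod A C) : AddCommGroup (T.Und X) := inferInstanceAs (AddCommGroup X.carrier)
instance (X : RComod A C) : Module Aᵐᵒᵖ (T.Und X) := inferInstanceAs (Module Aᵐᵒᵖ X.carrier)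

theorem coact_ctr (X : RComod A C) (x : X.carrier) (g : C →ₗ[A] A) :
    X.coact (ctr X.carrier g (X.coact x)) = lT X.carrier (hit g) (X.coact x) := by
  rw [← ctr_rT, X.coassoc, ctr_assocInv]

/-- The right `B`-module structure of a comodule: `x · b = ∑ x₀ ⟨x₁, b⟩`. -/
@[reducible] def comodModule (X : RComod A C) : Module Bᵐᵒᵖ X.carrier where
  smul b x := ctr X.carrier (T.beta b.unop) (X.coact x)
  one_smul (x : X.carrier) := by
    change ctr X.carrier (T.beta 1) (X.coact x) = x
    rw [T.beta_one, X.counit]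
  mul_smul b b' (x : X.carrier) := by
    change ctr X.carrier (T.beta (b'.unop * b.unop)) (X.coact x) =
      ctr X.carrier (T.beta b.unop) (X.coact (ctr X.carrier (T.beta b'.unop) (X.coact x)))
    rw [coact_ctr, ctr_lT, T.beta_mul]; rfl
  smul_zero b := by
    change ctr X.carrier (T.beta b.unop) (X.coact 0) = 0
    rw [map_zero, map_zero]
  smul_add b (x : X.carrier) (y : X.carrier) := by
    change ctr X.carrier (T.beta b.unop) (X.coact (x + y)) =
      ctr X.carrier (T.beta b.unop) (X.coact x) + ctr X.carrier (T.beta b.unop) (X.coact y)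
    rw [map_add, map_add]
  add_smul b b' (x : X.carrier) := by
    change ctr X.carrier (T.beta (b.unop + b'.unop)) (X.coact x) =
      ctr X.carrier (T.beta b.unop) (X.coact x) + ctr X.carrier (T.beta b'.unop) (X.coact x)
    rw [← ctr_add]; congr 1; congr 1; ext c; exact map_add (T.form c) _ _
  zero_smul (x : X.carrier) := by
    change ctr X.carrier (T.beta 0) (X.coact x) = 0
    have : T.beta 0 = 0 := by ext c; exact map_zero (T.form c)
    rw [this, ctr_zero]

instance (X : RComod A C) : Module Bᵐᵒᵖ (T.Und X) := T.comodModule X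

theorem und_smul (X : RComod A C) (b : B) (x : X.carrier) :
    (op b • (show T.Und X from x) : T.Und X) = ctr X.carrier (T.beta b) (X.coact x) := rfl

instance (X : RComod A C) : IsRestr φ (T.Und X) where
  smul_eq a (x : X.carrier) := by
    change ctr X.carrier (T.beta (φ a)) (X.coact x) = (op a • x : X.carrier)
    rw [← mul_one (φ a), ← ctr_op_smul, ← map_smul, T.beta_one, X.counit]

/-- A colinear map is `B`-linear. -/
def undMap {X Y : RComod A C} (f : X ⟶ Y) : T.Und X →ₗ[Bᵐᵒᵖ] T.Und Y where
  toFun := f.lin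
  map_add' := map_add f.lin
  map_smul' b (x : X.carrier) := by
    change f.lin (ctr X.carrier (T.beta b.unop) (X.coact x)) =
      ctr Y.carrier (T.beta b.unop) (Y.coact (f.lin x))
    rw [f.comm, ctr_rT]

/-- The inclusion functor `i : Comod-C ⥤ Mod-B`. -/
def incl : RComod A C ⥤ ModuleCat.{u} Bᵐᵒᵖ where
  obj X := ModuleCat.of Bᵐᵒᵖ (T.Und X)
  map f := ModuleCat.ofHom (T.undMap f)
  map_id _ := rfl
  map_comp _ _ := rfl

/-! ### The coinduction functor -/

/-- The right dual `Σ* = Hom_B(Σ, B)` of a comodule `Σ` seen as a right `B`-module. -/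
def Dual (S : RComod A C) : Type u := T.Und S →ₗ[Bᵐᵒᵖ] B

namespace Dual

variable {T} {S : RComod A C}

instance : AddCommGroup (Dual T S) := inferInstanceAs (AddCommGroup (T.Und S →ₗ[Bᵐᵒᵖ] B))

/-- `(b · u)(v) = b u(v)`. -/
instance : Module B (Dual T S) := inferInstanceAs (Module B (T.Und S →ₗ[Bᵐᵒᵖ] B))

/-- `(u · t)(v) = u(t(v))` for a colinear endomorphism `t`. -/
instance : Module (End S)ᵐᵒᵖ (Dual T S) where
  smul t u := LinearMap.comp (show T.Und S →ₗ[Bᵐᵒᵖ] B from u) (T.undMap t.unop)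
  one_smul _ := rfl
  mul_smul _ _ _ := rfl
  smul_zero t := LinearMap.zero_comp (T.undMap t.unop)
  smul_add t u v := LinearMap.add_comp (T.undMap t.unop) v u
  add_smul t t' u := LinearMap.comp_add (T.undMap t.unop) (T.undMap t'.unop) u
  zero_smul u := LinearMap.comp_zero u

instance : SMulCommClass B (End S)ᵐᵒᵖ (Dual T S) where
  smul_comm _ _ _ := rfl

end Dual

/-- The right `B`-module `Hom_T(Σ*, Y)`, where `T = End(Σ)`: `(g · b)(u) = g(b · u)`. -/
instance dualHomModule (S : RComod A C) (Y : Type u) [AddCommGroup Y] [Module (End S)ᵐᵒᵖ Y] :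
    Module Bᵐᵒᵖ (Dual T S →ₗ[(End S)ᵐᵒᵖ] Y) where
  smul b g := g ∘ₗ Module.toModuleEnd (End S)ᵐᵒᵖ (S := B) (Dual T S) b.unop
  one_smul g := by
    ext u; exact congrArg g (one_smul B u)
  mul_smul b b' g := by
    ext u; exact congrArg g (mul_smul b'.unop b.unop u)
  smul_zero b := LinearMap.zero_comp _
  smul_add b g g' := LinearMap.add_comp _ g' g
  add_smul b b' g := by
    ext u; exact (congrArg g (add_smul b.unop b'.unop u)).trans (map_add g _ _)
  zero_smul g := by
    ext u; exact (congrArg g (zero_smul B u)).trans (map_zero g)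

/-- The functor `Hom_T(Σ*, -) : Mod-T ⥤ Mod-B`. -/
def dualHom (S : RComod A C) : ModuleCat.{u} (End S)ᵐᵒᵖ ⥤ ModuleCat.{u} Bᵐᵒᵖ where
  obj Y := ModuleCat.of Bᵐᵒᵖ (Dual T S →ₗ[(End S)ᵐᵒᵖ] Y)
  map f := ModuleCat.ofHom
    { toFun := fun g => f.hom ∘ₗ g
      map_add' := fun g g' => LinearMap.comp_add g g' f.hom
      map_smul' := fun _ _ => by ext; rfl }
  map_id _ := rfl
  map_comp _ _ := rfl

/-- The coinduction functor `Coind_Σ = Rat ∘ Hom_T(Σ*, -) : Mod-T ⥤ Comod-C`. -/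
def coind (S : RComod A C) : ModuleCat.{u} (End S)ᵐᵒᵖ ⥤ RComod A C := T.dualHom S ⋙ T.ratFunctor

/-! ### The abelian category of comodules

Comodules are the same as rational `B`-modules, hence they form an abelian category. -/

/-- The `B`-modules all of whose elements are rational. -/
def rationalModules : ObjectProperty (ModuleCat.{u} Bᵐᵒᵖ) :=
  fun M => ∀ m : Restr φ M, m ∈ T.rat (Restr φ M)

theorem hom_mem_rat {M N : ModuleCat.{u} Bᵐᵒᵖ} (f : M ⟶ N) (m : M)
    (hm : (show Restr φ M from m) ∈ T.rat (Restr φ M)) :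
    (show Restr φ N from f m) ∈ T.rat (Restr φ N) :=
  T.map_mem_rat (M := Restr φ M) (M' := Restr φ N)
    { toFun := f.hom
      map_add' := map_add f.hom
      map_smul' := fun a m => f.hom.map_smul (φ.op a) m }
    (fun b m => f.hom.map_smul (op b) m) m hm

instance : T.rationalModules.IsClosedUnderQuotients where
  prop_of_epi {M N} f _ h n := by
    obtain ⟨m, rfl⟩ := (ModuleCat.epi_iff_surjective f).1 inferInstance n
    exact T.hom_mem_rat f m (h m)

instance : T.rationalModules.IsClosedUnderSubobjects where
  prop_of_mono {M N} f _ h m := by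
    have hf := (ModuleCat.mono_iff_injective f).1 inferInstance
    let g : Restr φ M →ₗ[Aᵐᵒᵖ] Restr φ N :=
      { toFun := f.hom
        map_add' := map_add f.hom
        map_smul' := fun a m => f.hom.map_smul (φ.op a) m }
    let K : Submodule Aᵐᵒᵖ (Restr φ N) := LinearMap.range g
    let e : Restr φ M ≃ₗ[Aᵐᵒᵖ] K := LinearEquiv.ofInjective g hf
    obtain ⟨z, hz⟩ := h (g m)
    have hb : ∀ b : B, op b • g m = g (op b • m) := fun b => (f.hom.map_smul (op b) m).symm
    obtain ⟨w, rfl⟩ := exists_of_rT_mkQ K z (T.alpha_injective _ (by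
      funext b
      unfold BalancedForm.alpha
      rw [ctr_rT, map_zero, Submodule.mkQ_apply, Submodule.Quotient.mk_eq_zero]
      have := hz b
      rw [hb] at this
      exact ⟨_, this⟩))
    refine ⟨rT C e.symm.toLinearMap w, fun b => hf ?_⟩
    change g _ = g _
    rw [← hb, hz]
    unfold BalancedForm.alpha
    rw [ctr_rT, ctr_rT]
    exact (congrArg Subtype.val (e.apply_symm_apply (ctr K (T.beta b) w))).symm

instance : T.rationalModules.ContainsZero where
  exists_zero := ⟨ModuleCat.of Bᵐᵒᵖ PUnit, ModuleCat.isZero_of_subsingleton _, fun m => by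
    have : m = 0 := Subsingleton.elim (α := PUnit) _ _
    rw [this]; exact zero_mem _⟩

instance : T.rationalModules.IsClosedUnderBinaryProducts :=
  ObjectProperty.IsClosedUnderLimitsOfShape.mk' (by
    rintro _ ⟨F, hF⟩
    let l : F.obj ⟨.left⟩ ⟶ limit F := limit.lift F
      { pt := _, π := Discrete.natTrans (by rintro ⟨_ | _⟩; exacts [𝟙 _, 0]) }
    let r : F.obj ⟨.right⟩ ⟶ limit F := limit.lift F
      { pt := _, π := Discrete.natTrans (by rintro ⟨_ | _⟩; exacts [0, 𝟙 _]) }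
    have h : limit.π F ⟨.left⟩ ≫ l + limit.π F ⟨.right⟩ ≫ r = 𝟙 _ := by
      apply limit.hom_ext
      rintro ⟨_ | _⟩ <;> simp [l, r]
    intro m
    have hm : l (limit.π F ⟨.left⟩ m) + r (limit.π F ⟨.right⟩ m) = m :=
      congrArg (fun f : limit F ⟶ limit F => f m) h
    have := add_mem (T.hom_mem_rat l _ (hF ⟨.left⟩ (limit.π F ⟨.left⟩ m)))
      (T.hom_mem_rat r _ (hF ⟨.right⟩ (limit.π F ⟨.right⟩ m)))
    exact hm ▸ this)

instance : T.rationalModules.IsClosedUnderFiniteProducts :=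
  ObjectProperty.IsClosedUnderFiniteProducts.mk'

instance : Abelian T.rationalModules.FullSubcategory where

theorem incl_mem (X : RComod A C) : T.rationalModules (T.incl.obj X) := fun m =>
  T.map_mem_rat (M := T.Und X) (M' := Restr φ (T.Und X))
    { toFun := fun x => x
      map_add' := fun _ _ => rfl
      map_smul' := fun a x => (IsRestr.smul_eq (φ := φ) a.unop x).symm }
    (fun _ _ => rfl) m ⟨X.coact m, fun _ => rfl⟩

/-- Comodules as rational modules. -/
def toRational : RComod A C ⥤ T.rationalModules.FullSubcategory :=
  T.rationalModules.lift T.incl T.incl_mem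

instance : T.incl.Faithful where
  map_injective {X Y f g} h := by
    ext x
    exact congrArg (fun k : T.incl.obj X ⟶ T.incl.obj Y => k x) h

instance : T.incl.Full where
  map_surjective {X Y} f := by
    let g : X.carrier →ₗ[Aᵐᵒᵖ] Y.carrier :=
      { toFun := fun x => f.hom x
        map_add' := map_add f.hom
        map_smul' := fun a x => by
          have h := f.hom.map_smul (op (φ a.unop)) x
          have h1 := IsRestr.smul_eq (φ := φ) (M := T.Und X) a.unop x
          have h2 := IsRestr.smul_eq (φ := φ) (M := T.Und Y) a.unop (f.hom x)
          exact (congrArg f.hom h1).symm.trans (h.trans h2) }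
    exact ⟨RComod.Hom.mk (X := X) (Y := Y) g fun x => T.tens_ext fun b => by
      rw [ctr_rT]
      exact (f.hom.map_smul (op b) x).symm, rfl⟩

instance : T.toRational.Faithful := inferInstanceAs (T.rationalModules.lift _ _).Faithful
instance : T.toRational.Full := inferInstanceAs (T.rationalModules.lift _ _).Full

instance : T.toRational.EssSurj where
  mem_essImage M := by
    let e : T.Und (T.ratComod (Restr φ M.obj)) ≃ₗ[Bᵐᵒᵖ] M.obj :=
        { toFun := fun m : T.rat (Restr φ M.obj) => (m : Restr φ M.obj)
          invFun := fun m => (⟨m, M.property m⟩ : T.rat (Restr φ M.obj))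
          map_add' := fun _ _ => rfl
          map_smul' := fun b m => T.ratCoact_spec (M := Restr φ M.obj) m b.unop
          left_inv := fun _ => rfl
          right_inv := fun _ => rfl }
    exact ⟨T.ratFunctor.obj M.obj, ⟨T.rationalModules.isoMk e.toModuleIso⟩⟩

instance : T.toRational.IsEquivalence where

theorem hasFiniteProducts (T : RationalPairing A C B φ) : HasFiniteProducts (RComod A C) :=
  ⟨fun _ => Adjunction.hasLimitsOfShape_of_equivalence T.toRational⟩

/-- `Comod-C` is an abelian category. -/
@[reducible] def abelian : Abelian (RComod A C) :=
  haveI := T.hasFiniteProducts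
  abelianOfEquivalence T.toRational

/-! ### The kernel of the coinvariant functor and the quotient category -/

end RationalPairing

/-- The coinvariant functor `Hom_C(Σ, -) : Comod-C ⥤ Mod-T`, `T = End(Σ)`; the ring `T` acts on
the right by composition. -/
abbrev coinv (S : RComod A C) : RComod A C ⥤ ModuleCat.{u} (End S)ᵐᵒᵖ := preadditiveCoyonedaObj S

/-- `C_Σ`, the comodules `L` with `Hom_C(Σ, L) = 0`. -/
def kernelClass (S : RComod A C) : ObjectProperty (RComod A C) := fun L => ∀ f : S ⟶ L, f = 0

theorem kernelClass_eq (S : RComod A C) :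
    kernelClass S = ObjectProperty.inverseImage (IsZero (C := ModuleCat (End S)ᵐᵒᵖ)) (coinv S) := by
  ext L
  refine ⟨fun h => ?_, fun h f => ?_⟩
  · have : Subsingleton ((coinv S).obj L) := ⟨fun f g => (h f).trans (h g).symm⟩
    exact ModuleCat.isZero_of_subsingleton _
  · have := ModuleCat.subsingleton_of_isZero h
    exact Subsingleton.elim (α := (coinv S).obj L) f 0

namespace RationalPairing

variable (T : RationalPairing A C B φ) (S : RComod A C) [Projective S]

theorem isSerreClass : letI := T.abelian; (kernelClass S).IsSerreClass := by
  let := T.abelian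
  rw [kernelClass_eq]
  have : PreservesFiniteColimits (coinv S) :=
    preservesFiniteColimits_preadditiveCoyonedaObj_of_projective S
  infer_instance

/-- The colinear maps whose kernel and cokernel lie in `C_Σ`. -/
def isoMod : MorphismProperty (RComod A C) :=
  letI := T.abelian
  haveI := T.isSerreClass S
  (kernelClass S).isoModSerre

/-- The quotient category `Comod-C / C_Σ`. -/
abbrev Quot : Type (u + 1) := (T.isoMod S).Localization

/-- The canonical functor `T_Σ : Comod-C ⥤ Comod-C / C_Σ`. -/
abbrev loc : RComod A C ⥤ T.Quot S := (T.isoMod S).Q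

end RationalPairing

end Pairing

/-! ### Torsion theories -/

section Torsion

variable {D : Type*} [Category* D] [HasZeroMorphisms D]

/-- A torsion theory: `Hom(X, Y) = 0` for `X` in the torsion class `P` and `Y` in the torsion-free
class `F`, and both classes are maximal with this property. -/
structure IsTorsionTheory (P F : ObjectProperty D) : Prop where
  hom_eq_zero : ∀ X Y, P X → F Y → ∀ f : X ⟶ Y, f = 0
  torsion : ∀ X, (∀ Y, F Y → ∀ f : X ⟶ Y, f = 0) → P X
  torsionFree : ∀ Y, (∀ X, P X → ∀ f : X ⟶ Y, f = 0) → F Y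

/-- A TTF-class: a class of objects which is both a torsion-free class and a torsion class. -/
def IsTTFClass (F : ObjectProperty D) : Prop :=
  (∃ P : ObjectProperty D, IsTorsionTheory P F) ∧ ∃ Q : ObjectProperty D, IsTorsionTheory F Q

end Torsion

end CoringCoind

end

noncomputable section

namespace CoringCoind

namespace RationalPairing

variable {A : Type u} [Ring A] {C : Type u} [AddCommGroup C] [Module A C] [Module Aᵐᵒᵖ C]
  [SMulCommClass A Aᵐᵒᵖ C] [Coring A C] {B : Type u} [Ring B] {φ : A →+* B}
  (T : RationalPairing A C B φ)

/-! ### The adjunction between the inclusion of comodules and the rational functor -/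

/-! Through `T.incl`, comodules form a full subcategory of right `B`-modules, closed under
submodules and quotients, with right adjoint Rat (`inclAdjunction`). The plan is to make Hom_C(Σ, -)
an exact functor with a fully faithful right adjoint; every claim then follows formally.

The hypotheses on Σ are first transported to `B`-modules. A left adjoint whose right adjoint is
exact preserves projectives, so Σ is projective over `B` (`projective_und`). Every `B`-submodule of
Σ is a subcomodule and Σ is the directed union of its finitely generated ones, so compactness makes
Σ finitely generated over `B` (`finite_und`). Hence Σ has a finite dual basis (eᵢ, eᵢ*).

With a dual basis, Hom_C(Σ, X) = Hom_B(Σ, X) is X ⊗_B Σ*, where x ⊗ u stands for the rank-one map s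
↦ x · u(s). Tensor-hom adjunction followed by `inclAdjunction` gives Hom_C(Σ, -) ⊣ Coind_Σ
(`coinvAdjunction`). No tensor product over `B` is formed: the two directions are f ↦ (x ↦ (u ↦ f(x
· u))) and g ↦ (h ↦ ∑ g(h(eᵢ))(eᵢ*)). The counit is invertible (`isIso_coinvAdjunction_counit`),
because Hom_C(Σ, Coind_Σ Y) is Hom_B(Σ, Hom_T(Σ*, Y)), and Σ ⊗_B Σ* ≅ T identifies this with Y.

Consequently Hom_C(Σ, -) is itself a localization at the maps with kernel and cokernel in C_Σ
(`isLocalization_coinv`), which compares the quotient category with Mod-T. The TTF property comes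
from the vanishing of the adjunction unit on C_Σ (`isTTFClass_kernelClass`). -/

/-- The inclusion `Rat(M) → M` as a `B`-linear map. -/
def ratInclusion (M : ModuleCat.{u} Bᵐᵒᵖ) : T.incl.obj (T.ratFunctor.obj M) ⟶ M :=
  ModuleCat.ofHom (X := T.Und (T.ratComod (Restr φ M)))
    { toFun := fun m : T.rat (Restr φ M) => (m : Restr φ M)
      map_add' := fun _ _ => rfl
      map_smul' := fun b m => T.ratCoact_spec (M := Restr φ M) m b.unop }

theorem ratInclusion_injective (M : ModuleCat.{u} Bᵐᵒᵖ) :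
    Function.Injective (T.ratInclusion M) := fun _ _ h =>
  Subtype.ext (p := (· ∈ T.rat (Restr φ M))) h

instance (M : ModuleCat.{u} Bᵐᵒᵖ) : Mono (T.ratInclusion M) :=
  (ModuleCat.mono_iff_injective _).2 (T.ratInclusion_injective M)

/-- A `B`-linear map from a comodule corestricts to the rational part of the target. -/
def toRat {X : RComod A C} {M : ModuleCat.{u} Bᵐᵒᵖ} (g : T.incl.obj X ⟶ M) :
    X ⟶ T.ratFunctor.obj M :=
  T.incl.preimage (ModuleCat.ofHom (Y := T.Und (T.ratComod (Restr φ M)))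
    { toFun := fun x => (⟨g x, T.hom_mem_rat g x (T.incl_mem X x)⟩ : T.rat (Restr φ M))
      map_add' := fun x y => Subtype.ext (map_add g.hom x y)
      map_smul' := fun b x => Subtype.ext ((g.hom.map_smul b x).trans
        (T.ratCoact_spec (M := Restr φ M) ⟨g x, _⟩ b.unop).symm) })

theorem incl_map_toRat {X : RComod A C} {M : ModuleCat.{u} Bᵐᵒᵖ} (g : T.incl.obj X ⟶ M) :
    T.incl.map (T.toRat g) ≫ T.ratInclusion M = g := by
  exact congrArg (· ≫ T.ratInclusion M) (T.incl.map_preimage _)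

theorem toRat_incl_map {X : RComod A C} {M : ModuleCat.{u} Bᵐᵒᵖ} (f : X ⟶ T.ratFunctor.obj M) :
    T.toRat (T.incl.map f ≫ T.ratInclusion M) = f :=
  T.incl.map_injective (by rw [← cancel_mono (T.ratInclusion M), incl_map_toRat])

/-- `T.incl` is faithful and Rat(M') → M' is mono, so both sides may be compared as `B`-linear maps
into M'. This is the naturality needed for the adjunction. -/
theorem toRat_comp {X : RComod A C} {M M' : ModuleCat.{u} Bᵐᵒᵖ} (f : T.incl.obj X ⟶ M)
    (g : M ⟶ M') : T.toRat (f ≫ g) = T.toRat f ≫ T.ratFunctor.map g :=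
  T.incl.map_injective (by
    rw [← cancel_mono (T.ratInclusion M'), incl_map_toRat, Functor.map_comp, Category.assoc]
    conv_lhs => rw [← T.incl_map_toRat f, Category.assoc]
    rfl)

/-- The inclusion of comodules into `B`-modules is left adjoint to the rational functor. -/
def inclAdjunction : T.incl ⊣ T.ratFunctor :=
  Adjunction.mkOfHomEquiv
    { homEquiv := fun X M =>
        { toFun := T.toRat
          invFun := fun f => T.incl.map f ≫ T.ratInclusion M
          left_inv := T.incl_map_toRat
          right_inv := T.toRat_incl_map }
      homEquiv_naturality_left_symm := fun f g => by
        simp only [Equiv.coe_fn_symm_mk, Functor.map_comp, Category.assoc]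
      homEquiv_naturality_right := T.toRat_comp }

/-! ### Finitely generated projective comodules are finitely generated projective `B`-modules -/

/-- Exactness of Rat enters here: the right adjoint preserves epimorphisms, so its left adjoint
`T.incl` preserves projective objects. -/
theorem projective_und (hRat : exactFunctor (ModuleCat.{u} Bᵐᵒᵖ) (RComod A C) T.ratFunctor)
    (S : RComod A C) [Projective S] : Module.Projective Bᵐᵒᵖ (T.Und S) := by
  have : PreservesFiniteColimits T.ratFunctor := hRat.2
  exact (IsProjective.iff_projective (T.Und S)).2
    (T.inclAdjunction.map_projective S inferInstance)

/-! ### Subcomodules from `B`-submodules, and finite generation -/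

theorem isIso_of_mono_of_surjective (T : RationalPairing A C B φ) {X Y : RComod A C}
    (f : X ⟶ Y) [Mono f] (hf : Function.Surjective f.lin) : IsIso f := by
  let := T.abelian
  have : Epi (T.incl.map f) := (ModuleCat.epi_iff_surjective _).2 hf
  -- A faithful functor reflects epimorphisms, and abelian categories are balanced.
  have : Epi f := T.incl.epi_of_epi_map this
  exact isIso_of_mono_of_epi f

/-- The inclusion into `S` of a `B`-submodule. -/
def submoduleInclusion (S : RComod A C) (N : Submodule Bᵐᵒᵖ (T.Und S)) :
    ModuleCat.of Bᵐᵒᵖ N ⟶ T.incl.obj S :=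
  ModuleCat.ofHom N.subtype

instance (S : RComod A C) (N : Submodule Bᵐᵒᵖ (T.Und S)) : Mono (T.submoduleInclusion S N) :=
  (ModuleCat.mono_iff_injective _).2 N.subtype_injective

/-- The inclusion into `S` of the comodule given by a `B`-submodule of `S`. -/
def subcomoduleMap (S : RComod A C) (N : Submodule Bᵐᵒᵖ (T.Und S)) :
    T.ratFunctor.obj (ModuleCat.of Bᵐᵒᵖ N) ⟶ S :=
  T.incl.preimage (T.ratInclusion (ModuleCat.of Bᵐᵒᵖ N) ≫ T.submoduleInclusion S N)

theorem incl_map_subcomoduleMap (S : RComod A C) (N : Submodule Bᵐᵒᵖ (T.Und S)) :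
    T.incl.map (T.subcomoduleMap S N) =
      T.ratInclusion (ModuleCat.of Bᵐᵒᵖ N) ≫ T.submoduleInclusion S N :=
  T.incl.map_preimage _

instance (S : RComod A C) (N : Submodule Bᵐᵒᵖ (T.Und S)) : Mono (T.subcomoduleMap S N) := by
  have : Mono (T.incl.map (T.subcomoduleMap S N)) := by
    rw [incl_map_subcomoduleMap]
    infer_instance
  exact T.incl.mono_of_mono_map this

/-- Submodules of rational modules are rational, so passing from N to Rat(N) loses nothing: every
`B`-submodule of a comodule underlies a subcomodule. -/
theorem range_subcomoduleMap (S : RComod A C) (N : Submodule Bᵐᵒᵖ (T.Und S)) :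
    Set.range (T.subcomoduleMap S N).lin = (N : Set (T.Und S)) := by
  have h : ∀ x : T.rat (Restr φ N), (T.subcomoduleMap S N).lin x =
      N.subtype (show Restr φ N from x) := fun x =>
    congrArg (fun f : T.incl.obj (T.ratFunctor.obj (ModuleCat.of Bᵐᵒᵖ N)) ⟶ T.incl.obj S => f x)
      (T.incl_map_subcomoduleMap S N)
  ext s
  constructor
  · rintro ⟨x, rfl⟩
    exact Set.mem_of_eq_of_mem (h x) (T.ratInclusion (ModuleCat.of Bᵐᵒᵖ N) x).2
  · intro hs
    have hN : T.rationalModules (ModuleCat.of Bᵐᵒᵖ N) :=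
      T.rationalModules.prop_of_mono (T.submoduleInclusion S N) (T.incl_mem S)
    exact ⟨(⟨(⟨s, hs⟩ : N), hN _⟩ : T.rat (Restr φ N)), h _⟩

/-- Compactness is tested on the directed family of subcomodules coming from finitely generated
`B`-submodules. Its least upper bound is ⊤, so some member of the family is already all of Σ. -/
theorem finite_und (S : RComod A C) (hS : IsCompactElement (⊤ : Subobject S)) :
    Module.Finite Bᵐᵒᵖ (T.Und S) := by
  have hle : ∀ N N' : Submodule Bᵐᵒᵖ (T.Und S), N ≤ N' →
      Subobject.mk (T.subcomoduleMap S N) ≤ Subobject.mk (T.subcomoduleMap S N') := by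
    intro N N' h
    refine Subobject.mk_le_mk_of_comm
      (T.ratFunctor.map (ModuleCat.ofHom (Submodule.inclusion h))) ?_
    apply T.incl.map_injective
    rw [Functor.map_comp, incl_map_subcomoduleMap, incl_map_subcomoduleMap]
    rfl
  obtain ⟨_, ⟨N, hN, rfl⟩, h⟩ := hS
    ((fun N => Subobject.mk (T.subcomoduleMap S N)) '' {N | N.FG}) ⊤
    ⟨_, ⊥, Submodule.fg_bot, rfl⟩
    (by
      rintro _ ⟨N, hN, rfl⟩ _ ⟨N', hN', rfl⟩
      exact ⟨_, ⟨N ⊔ N', hN.sup hN', rfl⟩, hle _ _ le_sup_left, hle _ _ le_sup_right⟩)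
    ⟨fun _ _ => le_top, fun P hP => by
      -- An upper bound P contains the cyclic submodule generated by each s, so its arrow is
      -- surjective and P = ⊤.
      have : IsIso P.arrow := T.isIso_of_mono_of_surjective _ fun s => by
        let N : Submodule Bᵐᵒᵖ (T.Und S) := Submodule.span Bᵐᵒᵖ {s}
        have hs : s ∈ Set.range (T.subcomoduleMap S N).lin := by
          rw [range_subcomoduleMap]
          exact Submodule.mem_span_singleton_self (R := Bᵐᵒᵖ) (M := T.Und S) s
        obtain ⟨x, hx⟩ := hs
        have hP' := hP ⟨N, Submodule.fg_span_singleton (R := Bᵐᵒᵖ) (M := T.Und S) s, rfl⟩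
        refine ⟨(Subobject.ofMkLE _ P hP').lin x, ?_⟩
        exact (congrArg (fun f => f.lin x) (Subobject.ofMkLE_arrow hP')).trans hx
      exact (Subobject.eq_top_of_isIso_arrow P).ge⟩ le_rfl
  have hiso : IsIso (T.subcomoduleMap S N) := Subobject.isIso_iff_mk_eq_top _ |>.2 (top_le_iff.1 h)
  have hsurj : Function.Surjective (T.subcomoduleMap S N).lin := fun s =>
    ⟨(inv (T.subcomoduleMap S N)).lin s,
      congrArg (fun f : S ⟶ S => f.lin s) (IsIso.inv_hom_id (T.subcomoduleMap S N))⟩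
  have hNtop : N = ⊤ := SetLike.coe_injective (by
    rw [← T.range_subcomoduleMap S N, hsurj.range_eq]; rfl)
  exact ⟨hNtop ▸ hN⟩

/-! ### Dual bases and the adjunction between coinvariants and coinduction -/

namespace Dual

variable {T} {S : RComod A C}

/-- An element of `Σ*` as a linear form. -/
def eval (u : Dual T S) : T.Und S →ₗ[Bᵐᵒᵖ] B := u

@[ext] theorem ext {u v : Dual T S} (h : ∀ s, u.eval s = v.eval s) : u = v :=
  LinearMap.ext h

theorem eval_smul (b : B) (u : Dual T S) (s : T.Und S) : (b • u).eval s = b * u.eval s := rfl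

theorem eval_op_smul (t : End S) (u : Dual T S) (s : T.Und S) :
    (op t • u).eval s = u.eval (T.undMap t s) := rfl

theorem eval_sum {ι : Type*} (I : Finset ι) (u : ι → Dual T S) (s : T.Und S) :
    (∑ i ∈ I, u i).eval s = ∑ i ∈ I, (u i).eval s :=
  LinearMap.sum_apply I u s

/-- The colinear map `s ↦ l · u(s)`, for `l ∈ L` and `u ∈ Σ*`. -/
def rankOne (u : Dual T S) {L : RComod A C} (l : T.Und L) : S ⟶ L :=
  T.incl.preimage (ModuleCat.ofHom
    { toFun := fun s : T.Und S => op (u.eval s) • l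
      map_add' := fun s s' => by rw [map_add, MulOpposite.op_add, add_smul]
      map_smul' := fun b s => by
        rw [map_smul, RingHom.id_apply, smul_smul]
        rfl })

theorem undMap_rankOne (u : Dual T S) {L : RComod A C} (l : T.Und L) (s : T.Und S) :
    T.undMap (u.rankOne l) s = op (u.eval s) • l :=
  congrArg (fun f : T.incl.obj S ⟶ T.incl.obj L => f s) (T.incl.map_preimage _)

end Dual

theorem hom_ext_und {X Y : RComod A C} {f g : X ⟶ Y} (h : ∀ x, T.undMap f x = T.undMap g x) :
    f = g :=
  RComod.hom_ext' h

theorem undMap_comp {X Y Z : RComod A C} (f : X ⟶ Y) (g : Y ⟶ Z) (x : T.Und X) :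
    T.undMap (f ≫ g) x = T.undMap g (T.undMap f x) := rfl

theorem undMap_sum {X Y : RComod A C} {ι : Type*} (I : Finset ι) (f : ι → (X ⟶ Y)) (x : T.Und X) :
    T.undMap (∑ i ∈ I, f i) x = ∑ i ∈ I, T.undMap (f i) x :=
  map_sum (AddMonoidHom.mk' (fun f : X ⟶ Y => T.undMap f x) (fun _ _ => rfl)) f I

/-- A finite dual basis of a comodule as a module over `B`. -/
structure DualBasis (S : RComod A C) where
  card : ℕ
  vec : Fin card → T.Und S
  coord : Fin card → Dual T S
  sum_smul : ∀ s, ∑ i, op ((coord i).eval s) • vec i = s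

/-- A surjection π from a finite free module onto Σ splits by projectivity. The eᵢ are the images of
the standard basis under π, and the eᵢ* are the coordinates of the section σ. -/
theorem nonempty_dualBasis (S : RComod A C) [Module.Finite Bᵐᵒᵖ (T.Und S)]
    [Module.Projective Bᵐᵒᵖ (T.Und S)] : Nonempty (T.DualBasis S) := by
  obtain ⟨n, π, hπ⟩ := Module.Finite.exists_fin' Bᵐᵒᵖ (T.Und S)
  obtain ⟨σ, hσ⟩ := Module.projective_lifting_property π LinearMap.id hπ
  refine ⟨⟨n, fun i => π (Pi.single i 1), fun i =>
    { toFun := fun s => unop (σ s i)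
      map_add' := fun s s' => by rw [map_add]; rfl
      map_smul' := fun b s => by rw [map_smul]; rfl }, fun s => ?_⟩⟩
  conv_rhs => rw [← LinearMap.id_apply (R := Bᵐᵒᵖ) s, ← hσ, LinearMap.comp_apply,
    pi_eq_sum_univ' (σ s), map_sum]
  refine Finset.sum_congr rfl fun i _ => ?_
  rw [map_smul]
  rfl

namespace DualBasis

variable {T} {S : RComod A C} (β : T.DualBasis S)

/-- Apply h to the expansion of s in the dual basis. So rank-one maps span Hom_C(Σ, L), the
surjectivity half of L ⊗_B Σ* ≅ Hom_C(Σ, L). -/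
theorem sum_rankOne {L : RComod A C} (h : S ⟶ L) :
    ∑ i, (β.coord i).rankOne (T.undMap h (β.vec i)) = h := T.hom_ext_und fun s => by
  rw [undMap_sum]
  conv_rhs => rw [← β.sum_smul s, map_sum]
  exact Finset.sum_congr rfl fun i _ => by rw [Dual.undMap_rankOne, map_smul]

/-- Apply u to the same expansion: the eᵢ* generate Σ* as a left `B`-module, with coefficients
u(eᵢ). -/
theorem sum_eval_smul_coord (u : Dual T S) : ∑ i, u.eval (β.vec i) • β.coord i = u := by
  ext s
  rw [Dual.eval_sum]
  conv_rhs => rw [← β.sum_smul s, map_sum]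
  exact Finset.sum_congr rfl fun i _ => by rw [Dual.eval_smul, map_smul]; rfl

end DualBasis

/-! ### The rank-one pairing and the tensor-hom adjunction -/

theorem rankOne_add {S L : RComod A C} (u : Dual T S) (l l' : T.Und L) :
    u.rankOne (l + l') = u.rankOne l + u.rankOne l' := T.hom_ext_und fun s => by
  change _ = T.undMap (u.rankOne l) s + T.undMap (u.rankOne l') s
  simp only [Dual.undMap_rankOne, smul_add]

theorem add_rankOne {S L : RComod A C} (u v : Dual T S) (l : T.Und L) :
    (u + v).rankOne l = u.rankOne l + v.rankOne l := T.hom_ext_und fun s => by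
  change _ = T.undMap (u.rankOne l) s + T.undMap (v.rankOne l) s
  simp only [Dual.undMap_rankOne, ← add_smul]
  rfl

/-- The pairing is balanced over `B`; this yields the `B`-linearity of `toDualHom`. -/
theorem rankOne_smul {S L : RComod A C} (b : B) (u : Dual T S) (l : T.Und L) :
    u.rankOne (op b • l) = (b • u).rankOne l := T.hom_ext_und fun s => by
  simp only [Dual.undMap_rankOne, Dual.eval_smul, smul_smul, op_mul]

theorem op_smul_rankOne {S L : RComod A C} (t : End S) (u : Dual T S) (l : T.Und L) :
    (op t • u).rankOne l = (show S ⟶ S from t) ≫ u.rankOne l := T.hom_ext_und fun s => by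
  rw [undMap_comp, Dual.undMap_rankOne, Dual.undMap_rankOne]
  rfl

/-- A `T`-linear map `Hom_C(Σ, X) → Y` gives the `B`-linear map
`X → Hom_T(Σ*, Y)`, `x ↦ (u ↦ f(x · u))`. -/
def toDualHom {S X : RComod A C} {Y : ModuleCat.{u} (End S)ᵐᵒᵖ} (f : (coinv S).obj X ⟶ Y) :
    T.incl.obj X ⟶ (T.dualHom S).obj Y :=
  ModuleCat.ofHom (X := T.Und X) (Y := Dual T S →ₗ[(End S)ᵐᵒᵖ] Y)
    { toFun := fun x =>
        { toFun := fun u => f (u.rankOne x)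
          map_add' := fun u v => (congrArg f (T.add_rankOne u v x)).trans (map_add f.hom _ _)
          map_smul' := fun t u =>
            (congrArg f (T.op_smul_rankOne t.unop u x)).trans (f.hom.map_smul t _) }
      map_add' := fun x x' => LinearMap.ext fun u =>
        (congrArg f (T.rankOne_add u x x')).trans (map_add f.hom _ _)
      map_smul' := fun b x => LinearMap.ext fun u => congrArg f (T.rankOne_smul b.unop u x) }

/-- Evaluation of a map to `Hom_T(Σ*, Y)`. -/
def dualHomEval {S X : RComod A C} {Y : ModuleCat.{u} (End S)ᵐᵒᵖ}
    (g : T.incl.obj X ⟶ (T.dualHom S).obj Y) : T.Und X →ₗ[Bᵐᵒᵖ] Dual T S →ₗ[(End S)ᵐᵒᵖ] Y :=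
  g.hom

theorem dualHomEval_smul {S X : RComod A C} {Y : ModuleCat.{u} (End S)ᵐᵒᵖ}
    (g : T.incl.obj X ⟶ (T.dualHom S).obj Y) (b : B) (x : T.Und X) (u : Dual T S) :
    T.dualHomEval g (op b • x) u = T.dualHomEval g x (b • u) := by
  rw [map_smul]
  rfl

/-- Given a dual basis, a `B`-linear map `g : X → Hom_T(Σ*, Y)` gives the `T`-linear map
`Hom_C(Σ, X) → Y`, `h ↦ ∑ g(h(eᵢ))(eᵢ*)`. -/
def ofDualHom {S X : RComod A C} (β : T.DualBasis S) {Y : ModuleCat.{u} (End S)ᵐᵒᵖ}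
    (g : T.incl.obj X ⟶ (T.dualHom S).obj Y) : (coinv S).obj X ⟶ Y :=
  ModuleCat.ofHom (X := (coinv S).obj X)
    { toFun := fun h : S ⟶ X => ∑ i, T.dualHomEval g (T.undMap h (β.vec i)) (β.coord i)
      map_add' := fun h h' : S ⟶ X => by
        rw [← Finset.sum_add_distrib]
        exact Finset.sum_congr rfl fun i _ =>
          congrArg (fun k => k (β.coord i)) (map_add (T.dualHomEval g) _ _)
      map_smul' := fun t (h : S ⟶ X) => by
        change ∑ i, T.dualHomEval g (T.undMap h (T.undMap t.unop (β.vec i))) (β.coord i) = _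
        -- Expand t(eᵢ) = ∑ⱼ eⱼ · (eⱼ* ∘ t)(eᵢ) and move the scalar onto eᵢ*. After the sums are
        -- exchanged, ∑ᵢ (eⱼ* ∘ t)(eᵢ) eᵢ* collapses to eⱼ* ∘ t, and `T`-linearity of g(h(eⱼ))
        -- extracts t.
        have h1 : ∀ i, T.dualHomEval g (T.undMap h (T.undMap t.unop (β.vec i))) (β.coord i) =
            ∑ j, T.dualHomEval g (T.undMap h (β.vec j))
              (((op t.unop • β.coord j).eval (β.vec i)) • β.coord i) := fun i => by
          conv_lhs => rw [← β.sum_smul (T.undMap t.unop (β.vec i))]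
          simp only [map_sum, map_smul, LinearMap.sum_apply]
          rfl
        simp only [h1]
        rw [Finset.sum_comm, RingHom.id_apply, Finset.smul_sum]
        refine Finset.sum_congr rfl fun j _ => ?_
        rw [← map_sum, β.sum_eval_smul_coord, map_smul]
        rfl }

theorem dualHomEval_toDualHom {S X : RComod A C} {Y : ModuleCat.{u} (End S)ᵐᵒᵖ}
    (f : (coinv S).obj X ⟶ Y) (x : T.Und X) (u : Dual T S) :
    T.dualHomEval (T.toDualHom f) x u = f (u.rankOne x) := rfl

theorem ofDualHom_apply {S X : RComod A C} (β : T.DualBasis S) {Y : ModuleCat.{u} (End S)ᵐᵒᵖ}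
    (g : T.incl.obj X ⟶ (T.dualHom S).obj Y) (h : S ⟶ X) :
    T.ofDualHom β g h = ∑ i, T.dualHomEval g (T.undMap h (β.vec i)) (β.coord i) := rfl

theorem dualHom_hom_ext {S X : RComod A C} {Y : ModuleCat.{u} (End S)ᵐᵒᵖ}
    {g g' : T.incl.obj X ⟶ (T.dualHom S).obj Y}
    (h : ∀ x u, T.dualHomEval g x u = T.dualHomEval g' x u) : g = g' :=
  ModuleCat.hom_ext (LinearMap.ext fun x => LinearMap.ext (h x))

/-- `Hom_T(Hom_C(Σ, X), Y) ≃ Hom_B(X, Hom_T(Σ*, Y))`. -/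
def dualHomEquiv {S : RComod A C} (β : T.DualBasis S) (X : RComod A C)
    (Y : ModuleCat.{u} (End S)ᵐᵒᵖ) :
    ((coinv S).obj X ⟶ Y) ≃ (T.incl.obj X ⟶ (T.dualHom S).obj Y) where
  toFun := T.toDualHom
  invFun := T.ofDualHom β
  left_inv f := ModuleCat.hom_ext (LinearMap.ext fun h : S ⟶ X => by
    change T.ofDualHom β (T.toDualHom f) h = f h
    rw [ofDualHom_apply]
    simp only [dualHomEval_toDualHom]
    exact (map_sum f.hom _ _).symm.trans (congrArg f (β.sum_rankOne h)))
  right_inv g := T.dualHom_hom_ext fun x u => by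
    rw [dualHomEval_toDualHom, ofDualHom_apply]
    simp only [Dual.undMap_rankOne, dualHomEval_smul]
    rw [← map_sum, β.sum_eval_smul_coord]

/-- `Hom_T(Hom_C(Σ, X), Y) ≃ Hom_C(X, Coind_Σ(Y))`. -/
def coindHomEquiv {S : RComod A C} (β : T.DualBasis S) (X : RComod A C)
    (Y : ModuleCat.{u} (End S)ᵐᵒᵖ) :
    ((coinv S).obj X ⟶ Y) ≃ (X ⟶ (T.coind S).obj Y) :=
  (T.dualHomEquiv β X Y).trans (T.inclAdjunction.homEquiv X ((T.dualHom S).obj Y))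

theorem coindHomEquiv_apply {S : RComod A C} (β : T.DualBasis S) {X : RComod A C}
    {Y : ModuleCat.{u} (End S)ᵐᵒᵖ} (f : (coinv S).obj X ⟶ Y) :
    T.coindHomEquiv β X Y f = T.toRat (T.toDualHom f) := by
  change T.inclAdjunction.homEquiv _ _ _ = _
  rw [inclAdjunction, Adjunction.mkOfHomEquiv_homEquiv]
  rfl

theorem coindHomEquiv_symm_apply {S : RComod A C} (β : T.DualBasis S) {X : RComod A C}
    {Y : ModuleCat.{u} (End S)ᵐᵒᵖ} (g : X ⟶ (T.coind S).obj Y) :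
    (T.coindHomEquiv β X Y).symm g =
      T.ofDualHom β (T.incl.map g ≫ T.ratInclusion ((T.dualHom S).obj Y)) := by
  change T.ofDualHom β ((T.inclAdjunction.homEquiv _ _).symm _) = _
  rw [inclAdjunction, Adjunction.mkOfHomEquiv_homEquiv]
  rfl

/-- The coinvariant functor is left adjoint to the coinduction functor. -/
def coinvAdjunction {S : RComod A C} (β : T.DualBasis S) : coinv S ⊣ T.coind S :=
  Adjunction.mkOfHomEquiv
    { homEquiv := T.coindHomEquiv β
      homEquiv_naturality_left_symm := fun f g => by
        rw [coindHomEquiv_symm_apply, coindHomEquiv_symm_apply]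
        rfl
      homEquiv_naturality_right := fun f g => by
        rw [coindHomEquiv_apply, coindHomEquiv_apply]
        exact T.toRat_comp (T.toDualHom f) ((T.dualHom S).map g) }

/-! ### Invertibility of the counit -/

theorem coinvAdjunction_counit_apply {S : RComod A C} (β : T.DualBasis S)
    (Y : ModuleCat.{u} (End S)ᵐᵒᵖ) (h : S ⟶ (T.coind S).obj Y) :
    (T.coinvAdjunction β).counit.app Y h =
      ∑ i, T.dualHomEval (T.incl.map h ≫ T.ratInclusion ((T.dualHom S).obj Y))
        (β.vec i) (β.coord i) := by
  rw [coinvAdjunction, Adjunction.mkOfHomEquiv_counit_app, coindHomEquiv_symm_apply]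
  rfl

/-- Both sides send s' to v(s) u(s'). This exchanges the `B`-action on Σ* for the action of the
rank-one endomorphism in `T`. -/
theorem eval_smul_eq_rankOne_smul {S : RComod A C} (u v : Dual T S) (s : T.Und S) :
    v.eval s • u = op (show End S from u.rankOne s) • v := Dual.ext fun s' => by
  rw [Dual.eval_smul, Dual.eval_op_smul, Dual.undMap_rankOne, map_smul]
  rfl

/-- A map to `Hom_T(Σ*, Y)` is determined by its values on a dual basis. -/
theorem dualHomEval_eq {S : RComod A C} (β : T.DualBasis S) {Y : ModuleCat.{u} (End S)ᵐᵒᵖ}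
    (g : T.incl.obj S ⟶ (T.dualHom S).obj Y) (s : T.Und S) (u : Dual T S) :
    T.dualHomEval g s u =
      op (show End S from u.rankOne s) • ∑ i, T.dualHomEval g (β.vec i) (β.coord i) := by
  -- Since g(eᵢ · eᵢ*(s))(u) = g(eᵢ)(eᵢ*(s) u) and eᵢ*(s) u = eᵢ* ∘ (s · u), the endomorphism s · u
  -- factors out of the sum by `T`-linearity.
  conv_lhs => rw [← β.sum_smul s, map_sum, LinearMap.sum_apply]
  rw [Finset.smul_sum]
  exact Finset.sum_congr rfl fun i _ => by
    rw [dualHomEval_smul, eval_smul_eq_rankOne_smul, map_smul]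

/-- The map `s ↦ (u ↦ y · (s · u))`. -/
def dualHomOfElement {S : RComod A C} {Y : ModuleCat.{u} (End S)ᵐᵒᵖ} (y : Y) :
    T.incl.obj S ⟶ (T.dualHom S).obj Y :=
  T.toDualHom (ModuleCat.ofHom (X := (coinv S).obj S)
    { toFun := fun t : End S => op t • y
      map_add' := fun t t' : End S => by rw [← add_smul]; rfl
      map_smul' := fun r (t : End S) => by rw [RingHom.id_apply, smul_smul]; rfl })

theorem dualHomEval_dualHomOfElement {S : RComod A C} {Y : ModuleCat.{u} (End S)ᵐᵒᵖ} (y : Y)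
    (s : T.Und S) (u : Dual T S) :
    T.dualHomEval (T.dualHomOfElement y) s u = op (show End S from u.rankOne s) • y := rfl

/-- By `dualHomEval_eq`, a map is recovered from its image under the counit, which gives
injectivity. A preimage of y is the map s ↦ (u ↦ y · (s · u)). -/
theorem isIso_coinvAdjunction_counit {S : RComod A C} (β : T.DualBasis S) :
    IsIso (T.coinvAdjunction β).counit := by
  have : ∀ Y, IsIso ((T.coinvAdjunction β).counit.app Y) := fun Y => by
    refine (ConcreteCategory.isIso_iff_bijective _).2
      ⟨(injective_iff_map_eq_zero ((T.coinvAdjunction β).counit.app Y).hom).2 ?_, fun y => ?_⟩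
    · intro (h : S ⟶ (T.coind S).obj Y) hh
      replace hh := (T.coinvAdjunction_counit_apply β Y h).symm.trans hh
      have hg : T.incl.map h ≫ T.ratInclusion ((T.dualHom S).obj Y) =
          T.incl.map (0 : S ⟶ (T.coind S).obj Y) ≫ T.ratInclusion ((T.dualHom S).obj Y) :=
        T.dualHom_hom_ext fun s u => by
          rw [T.dualHomEval_eq β, hh, smul_zero]
          rfl
      exact T.incl.map_injective
        ((cancel_mono (T.ratInclusion ((T.dualHom S).obj Y))).1 hg)
    · refine ⟨T.toRat (T.dualHomOfElement y),
        (T.coinvAdjunction_counit_apply β Y (T.toRat (T.dualHomOfElement y))).trans ?_⟩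
      have h1 : T.incl.map (T.toRat (T.dualHomOfElement y)) ≫
          T.ratInclusion ((T.dualHom S).obj Y) = T.dualHomOfElement y := T.incl_map_toRat _
      refine Eq.trans (congrArg (fun g => ∑ i, T.dualHomEval g (β.vec i) (β.coord i)) h1) ?_
      simp only [dualHomEval_dualHomOfElement]
      rw [← Finset.sum_smul]
      -- The counit returns y acted on by ∑ eᵢ · eᵢ*, which is the identity of Σ.
      refine Eq.trans (congrArg (· • y) ?_) (one_smul _ y)
      exact (map_sum (opAddEquiv (α := End S)) _ _).symm.trans
        (congrArg op (β.sum_rankOne (𝟙 S)))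
  exact NatIso.isIso_of_isIso_app _

theorem full_coind {S : RComod A C} (β : T.DualBasis S) : (T.coind S).Full :=
  have := T.isIso_coinvAdjunction_counit β
  (T.coinvAdjunction β).fullyFaithfulROfIsIsoCounit.full

theorem faithful_coind {S : RComod A C} (β : T.DualBasis S) : (T.coind S).Faithful :=
  have := T.isIso_coinvAdjunction_counit β
  (T.coinvAdjunction β).fullyFaithfulROfIsIsoCounit.faithful

/-! ### The quotient category -/

/-- The two companion classes are the left and right orthogonals of C_Σ. As a torsion-free class,
C_Σ is maximal because Σ lies in its left orthogonal. As a torsion class it is maximal by the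
adjunction argument below. -/
theorem isTTFClass_kernelClass {S : RComod A C} (β : T.DualBasis S) :
    IsTTFClass (kernelClass S) := by
  refine ⟨⟨fun X => ∀ Y, kernelClass S Y → ∀ f : X ⟶ Y, f = 0,
      fun X Y hX hY => hX Y hY, fun X h => h, fun Y h => h S fun Y hY => hY⟩,
    ⟨fun Y => ∀ X, kernelClass S X → ∀ f : X ⟶ Y, f = 0,
      fun X Y hX hY => hY X hX, fun X h => ?_, fun Y h => h⟩⟩
  -- Maps from C_Σ to an object Coind_Σ(Y) correspond to maps out of a zero module, so such objects
  -- are right orthogonal to C_Σ. Hence the unit at X vanishes; it is adjoint to the identity of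
  -- Hom_C(Σ, X), which is therefore zero.
  have adj := T.coinvAdjunction β
  have h0 := h ((T.coind S).obj ((coinv S).obj X)) (fun Z hZ f => by
    rw [kernelClass_eq] at hZ
    exact (adj.homEquiv _ _).symm.injective (hZ.eq_of_src _ _)) (adj.unit.app X)
  rw [kernelClass_eq]
  refine (IsZero.iff_id_eq_zero _).2 ((adj.homEquiv _ _).injective ?_)
  rw [adj.homEquiv_id, h0]
  exact ((adj.homEquiv_unit _ _ _).trans (by rw [h0, zero_comp])).symm

theorem isLocalization_coinv (S : RComod A C) [Projective S] (β : T.DualBasis S) :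
    (coinv S).IsLocalization (T.isoMod S) := by
  let := T.abelian
  have := T.isSerreClass S
  have : PreservesFiniteColimits (coinv S) :=
    preservesFiniteColimits_preadditiveCoyonedaObj_of_projective S
  have := T.full_coind β
  have := T.faithful_coind β
  -- An exact functor of abelian categories with fully faithful right adjoint is the localization at
  -- the Serre class of its kernel. Right exactness here is the projectivity of Σ.
  have h := Abelian.isLocalization_isoModSerre_kernel_of_leftAdjoint (T.coinvAdjunction β)
  unfold isoMod
  convert h using 2
  exact kernelClass_eq S

end RationalPairing

end CoringCoind

end

theorem mainTheorem4 {A : Type u} [Ring A] {C : Type u} [AddCommGroup C] [Module A C]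
    [Module Aᵐᵒᵖ C] [SMulCommClass A Aᵐᵒᵖ C] [CoringCoind.Coring A C] {B : Type u} [Ring B]
    (φ : A →+* B) (T : CoringCoind.RationalPairing A C B φ)
    (hRat : exactFunctor (ModuleCat.{u} Bᵐᵒᵖ) (CoringCoind.RComod A C) T.ratFunctor)
    (S : CoringCoind.RComod A C) [Projective S] (hS : IsCompactElement (⊤ : Subobject S)) :
    CoringCoind.IsTTFClass (CoringCoind.kernelClass S) ∧
    (T.loc S).IsLeftAdjoint ∧
    ∃ R : T.Quot S ⥤ ModuleCat.{u} (End S)ᵐᵒᵖ,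
      T.loc S ⋙ R = CoringCoind.coinv S ∧
      ∃ e : T.Quot S ≌ ModuleCat.{u} (End S)ᵐᵒᵖ,
        e.functor = R ∧ e.inverse = T.coind S ⋙ T.loc S := by
  have := T.projective_und hRat S
  have := T.finite_und S hS
  obtain ⟨β⟩ := T.nonempty_dualBasis S
  have := T.isLocalization_coinv S β
  have := T.full_coind β
  have := T.faithful_coind β
  have hW := Localization.inverts (CoringCoind.coinv S) (T.isoMod S)
  -- The strict lift from the constructed localization makes `T.loc S ⋙ R` equal to the coinvariant
  -- functor on the nose.
  let R := Localization.Construction.lift (CoringCoind.coinv S) hW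
  have hR : T.loc S ⋙ R = CoringCoind.coinv S := Localization.Construction.fac _ hW
  have : R.IsEquivalence := inferInstanceAs (Localization.Construction.lift _ hW).IsEquivalence
  let e := R.asEquivalence
  have adj := T.coinvAdjunction β
  -- Following Coind_Σ and the quotient functor by R gives Hom_C(Σ, Coind_Σ(-)), which the counit
  -- identifies with the identity; cancel the equivalence R.
  let i : T.coind S ⋙ T.loc S ≅ e.inverse :=
    (Functor.rightUnitor _).symm ≪≫
      Functor.isoWhiskerLeft (T.coind S ⋙ T.loc S) e.unitIso ≪≫
      Functor.isoWhiskerRight (Functor.isoWhiskerLeft (T.coind S) (eqToIso hR) ≪≫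
        asIso adj.counit) e.inverse ≪≫ Functor.leftUnitor _
  have j : CoringCoind.coinv S ⋙ e.inverse ≅ T.loc S :=
    Functor.isoWhiskerRight (eqToIso hR.symm) e.inverse ≪≫
      Functor.isoWhiskerLeft (T.loc S) e.unitIso.symm ≪≫ Functor.rightUnitor _
  -- Replacing the inverse along `i` makes it the prescribed functor by definition. The quotient
  -- functor is a left adjoint because, by `j`, it is Hom_C(Σ, -) followed by an equivalence.
  refine ⟨T.isTTFClass_kernelClass β, ?_, R, hR, e.changeInverse i.symm, rfl, rfl⟩
  have := adj.isLeftAdjoint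
  exact Functor.isLeftAdjoint_of_iso j
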